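/- All graphs are finite, simple, undirected and have at least one vertex. For non-adjacent distinct vertices $a,b$ of a graph $G$, an $a,b$-separator is a set $S\subseteq V(G)\setminus\{a,b\}$ such that $a$ and $b$ lie in different components of $G-S$; it is a minimal $a,b$-separator if no proper subset of it is an $a,b$-separator. A minimal separator of $G$ is a set that is a minimal $a,b$-separator for some pair of distinct non-adjacent vertices $a,b$; let $s(G)$ be the number of minimal separators of $G$. A class $\mathcal{G}$ of graphs is tame if there is a polynomial $p:\mathbb{R}\to\mathbb{R}$ such that $s(G)\le p(|V(G)|)$ for every $G\in\mathcal{G}$. Let $P_2+2P_1$ be the disjoint union of one edge and two isolated vertices, and $C_4$ the cycle on four vertices. A graph is $\{P_2+2P_1,C_4\}$-free if it has no induced subgraph isomorphic to $P_2+2P_1$ or $C_4$. **Proposition.** The class of $\{P_2+2P_1,C_4\}$-free graphs is tame. Moreover, the bounding polynomial can be chosen of degree at most $3$. -/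

import Mathlib

universe u

namespace SimpleGraph

/-- `S` is an `a,b`-separator of `G`: it avoids `a` and `b`, and these two vertices lie in
different connected components of `G - S`. -/
def IsSeparatorOf {V : Type u} (G : SimpleGraph V) (a b : V) (S : Set V) : Prop :=
  ∃ (ha : a ∈ Sᶜ) (hb : b ∈ Sᶜ),
    (G.induce Sᶜ).connectedComponentMk ⟨a, ha⟩ ≠ (G.induce Sᶜ).connectedComponentMk ⟨b, hb⟩

/-- `S` is a minimal `a,b`-separator: an `a,b`-separator that contains no other `a,b`-separator
as a proper subset. -/
def IsMinimalSeparatorOf {V : Type u} (G : SimpleGraph V) (a b : V) (S : Set V) : Prop :=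
  Minimal (G.IsSeparatorOf a b) S

/-- The set of minimal separators of `G`: the sets that are minimal `a,b`-separators for some
pair of distinct non-adjacent vertices `a`, `b`. -/
def minimalSeparators {V : Type u} (G : SimpleGraph V) : Set (Set V) :=
  {S | ∃ a b : V, a ≠ b ∧ ¬ G.Adj a b ∧ G.IsMinimalSeparatorOf a b S}

/-- The number `s(G)` of minimal separators of `G` (used for finite `G` only). -/
noncomputable def numMinimalSeparators {V : Type u} (G : SimpleGraph V) : ℕ :=
  G.minimalSeparators.ncard

/-- `G` is `ℱ`-free: no induced subgraph of `G` is isomorphic to a member of the family `ℱ`. -/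
def IsFamilyFree (ℱ : Set (Σ W : Type, SimpleGraph W)) {V : Type u} (G : SimpleGraph V) : Prop :=
  ∀ F ∈ ℱ, ¬ F.2.IsIndContained G

end SimpleGraph

/-- A class of graphs, given by its membership predicate. -/
def GraphClass : Type (u + 1) := ∀ V : Type u, SimpleGraph V → Prop

/-- The class of `ℱ`-free graphs. -/
def familyFreeClass (ℱ : Set (Σ W : Type, SimpleGraph W)) : GraphClass.{u} :=
  fun _ G => G.IsFamilyFree ℱ

/-- The polynomial `p` bounds the number of minimal separators on the class `𝒢`. Graphs are finite
and have at least one vertex. -/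
def GraphClass.IsBoundedBy (𝒢 : GraphClass.{u}) (p : Polynomial ℝ) : Prop :=
  ∀ (V : Type u) [Finite V] [Nonempty V] (G : SimpleGraph V), 𝒢 V G →
    (G.numMinimalSeparators : ℝ) ≤ p.eval (Nat.card V : ℝ)

/-- A graph class is tame if the number of minimal separators of its members is bounded by a
polynomial in the number of vertices. -/
def GraphClass.IsTame (𝒢 : GraphClass.{u}) : Prop :=
  ∃ p : Polynomial ℝ, 𝒢.IsBoundedBy p

/-- The graph `P₂ + 2P₁`: the disjoint union of one edge and two isolated vertices. -/
def graphP2Plus2P1 : SimpleGraph (Fin 2 ⊕ (Fin 1 ⊕ Fin 1)) :=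
  (SimpleGraph.pathGraph 2).sum ((SimpleGraph.pathGraph 1).sum (SimpleGraph.pathGraph 1))

/-- The family `{P₂ + 2P₁, C₄}`. -/
def familyP2Plus2P1C4 : Set (Σ W : Type, SimpleGraph W) :=
  {⟨_, graphP2Plus2P1⟩, ⟨_, SimpleGraph.cycleGraph 4⟩}

/-!
Let `S` be a minimal `a,b`-separator of a `{P₂ + 2P₁, C₄}`-free graph `G`, and let `A` and `B` be
the components of `a` and `b` in `G - S`. By minimality every vertex of `S` has a neighbour in `A`
and one in `B` (`exists_adj_component`).

If `A` has no edge, then `A = {a}` and `S` is the neighbourhood of `a`. Otherwise, as `P₂ + 2P₁` is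
forbidden, the set of vertices not adjacent to the ends of an edge of `A` is a clique; so `G - S`
has no third component, and `B` is a clique. The set `S` contains no three independent vertices
(`not_independent_triple`), and adjacent vertices of `S` have nested neighbourhoods in the clique
`B`, as `C₄` is forbidden. It follows that two vertices `d`, `d'` of `B` dominate `S`
(`exists_dominating_pair`). Then `S ∪ B` is the union of the closed neighbourhoods of `d` and `d'`,
so `A` is the complement of this union and `S` is the boundary of `A`. Hence the pair `(d, d')`
determines `S`, and `G`, if it has `n` vertices, has at most `n² + n` minimal separators.
-/

namespace SimpleGraph

variable {V : Type u} {G : SimpleGraph V}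

/-! ### Forbidden induced subgraphs -/

theorem IsFamilyFree.not_p2Plus2P1 (hG : G.IsFamilyFree familyP2Plus2P1C4) {u v x y : V}
    (huv : G.Adj u v) (hux : ¬ G.Adj u x) (huy : ¬ G.Adj u y) (hvx : ¬ G.Adj v x)
    (hvy : ¬ G.Adj v y) (hxy : ¬ G.Adj x y) (hne : x ≠ y) : False := by
  refine hG ⟨_, graphP2Plus2P1⟩ (Or.inl rfl) ⟨⟨⟨Sum.elim ![u, v] (Sum.elim ![x] ![y]), ?_⟩, ?_⟩⟩
  · have h1 : u ≠ v := huv.ne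
    have h2 : u ≠ x := fun h => hvx (h ▸ huv.symm)
    have h3 : u ≠ y := fun h => hvy (h ▸ huv.symm)
    have h4 : v ≠ x := fun h => hux (h ▸ huv)
    have h5 : v ≠ y := fun h => huy (h ▸ huv)
    rintro (i | i | i) (j | j | j) <;> fin_cases i <;> fin_cases j <;>
      simp [h1, h2, h3, h4, h5, hne, h1.symm, h2.symm, h3.symm, h4.symm, h5.symm, hne.symm]
  · have hvu := huv.symm
    have hxu : ¬ G.Adj x u := fun h => hux h.symm
    have hyu : ¬ G.Adj y u := fun h => huy h.symm
    have hxv : ¬ G.Adj x v := fun h => hvx h.symm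
    have hyv : ¬ G.Adj y v := fun h => hvy h.symm
    have hyx : ¬ G.Adj y x := fun h => hxy h.symm
    intro i j
    change G.Adj (Sum.elim ![u, v] (Sum.elim ![x] ![y]) i)
      (Sum.elim ![u, v] (Sum.elim ![x] ![y]) j) ↔ _
    rcases i with i | i | i <;> rcases j with j | j | j <;> fin_cases i <;> fin_cases j <;>
      simp [graphP2Plus2P1, pathGraph_adj, *]

theorem IsFamilyFree.not_c4 (hG : G.IsFamilyFree familyP2Plus2P1C4) {u v x y : V}
    (huv : G.Adj u v) (hvx : G.Adj v x) (hxy : G.Adj x y) (hyu : G.Adj y u)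
    (hux : ¬ G.Adj u x) (hvy : ¬ G.Adj v y) (hne : u ≠ x) (hne' : v ≠ y) : False := by
  refine hG ⟨_, cycleGraph 4⟩ (Or.inr rfl) ⟨⟨⟨![u, v, x, y], ?_⟩, ?_⟩⟩
  · intro i j
    fin_cases i <;> fin_cases j <;>
      simp [hne, hne', hne.symm, hne'.symm, huv.ne, huv.ne', hvx.ne, hvx.ne', hxy.ne, hxy.ne',
        hyu.ne, hyu.ne']
  · have hxu : ¬ G.Adj x u := fun h => hux h.symm
    have hyv : ¬ G.Adj y v := fun h => hvy h.symm
    intro i j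
    change G.Adj (![u, v, x, y] i) (![u, v, x, y] j) ↔ _
    fin_cases i <;> fin_cases j <;>
      simp [cycleGraph_adj, huv, hvx, hxy, hyu, hux, hvy, hxu, hyv, huv.symm, hvx.symm,
        hxy.symm, hyu.symm] <;> decide

/-! ### Full components of minimal separators -/

/-- The vertices of the connected component of `a` in `G - S`. It is empty if `a ∈ S`. -/
def componentAvoiding (G : SimpleGraph V) (S : Set V) (a : V) : Set V :=
  {v | ∃ (ha : a ∈ Sᶜ) (hv : v ∈ Sᶜ), (G.induce Sᶜ).Reachable ⟨a, ha⟩ ⟨v, hv⟩}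

theorem mem_of_reachable_induce {T : Set V} {A : Set V}
    (hA : ∀ u v, u ∈ A → v ∈ T → G.Adj u v → v ∈ A) {u v : T}
    (h : (G.induce T).Reachable u v) (hu : (u : V) ∈ A) : (v : V) ∈ A := by
  obtain ⟨p⟩ := h
  induction p with
  | nil => exact hu
  | @cons u v w huv _ ih => exact ih (hA u v hu v.2 huv)

theorem mem_componentAvoiding_of_adj {S : Set V} {a u v : V} (hu : u ∈ G.componentAvoiding S a)
    (hv : v ∉ S) (huv : G.Adj u v) : v ∈ G.componentAvoiding S a := by
  obtain ⟨ha, hu, h⟩ := hu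
  have hadj : (G.induce Sᶜ).Adj ⟨u, hu⟩ ⟨v, hv⟩ := huv
  exact ⟨ha, hv, h.trans hadj.reachable⟩

theorem notMem_of_mem_componentAvoiding {S : Set V} {a u : V}
    (hu : u ∈ G.componentAvoiding S a) : u ∉ S := hu.2.1

theorem mem_componentAvoiding_self {S : Set V} {a : V} (ha : a ∉ S) :
    a ∈ G.componentAvoiding S a := ⟨ha, ha, .refl _⟩

theorem componentAvoiding_subset_of_edgeless {S : Set V} {a : V}
    (h : ∀ u ∈ G.componentAvoiding S a, ∀ v ∈ G.componentAvoiding S a, ¬ G.Adj u v) :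
    G.componentAvoiding S a ⊆ {a} := by
  rintro v ⟨ha, hv, hr⟩
  refine mem_of_reachable_induce (fun u w hu hw huw => ?_) hr rfl
  obtain rfl : u = a := hu
  have hu := mem_componentAvoiding_self (G := G) ha
  exact (h _ hu _ (mem_componentAvoiding_of_adj hu hw huw) huw).elim

theorem IsSeparatorOf.symm {a b : V} {S : Set V} (h : G.IsSeparatorOf a b S) :
    G.IsSeparatorOf b a S := by
  obtain ⟨ha, hb, h⟩ := h
  exact ⟨hb, ha, h.symm⟩

theorem IsMinimalSeparatorOf.symm {a b : V} {S : Set V} (h : G.IsMinimalSeparatorOf a b S) :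
    G.IsMinimalSeparatorOf b a S :=
  ⟨h.1.symm, fun _ hT hle => h.2 hT.symm hle⟩

theorem IsSeparatorOf.notMem_component {a b u : V} {S : Set V} (h : G.IsSeparatorOf a b S)
    (hu : u ∈ G.componentAvoiding S a) : u ∉ G.componentAvoiding S b := by
  rintro ⟨hb, hu', hbu⟩
  obtain ⟨ha, _, hau⟩ := hu
  obtain ⟨_, _, hne⟩ := h
  exact hne (ConnectedComponent.sound (hau.trans hbu.symm))

theorem IsMinimalSeparatorOf.exists_adj_component {a b s : V} {S : Set V}
    (h : G.IsMinimalSeparatorOf a b S) (hs : s ∈ S) :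
    ∃ x ∈ G.componentAvoiding S a, G.Adj s x := by
  by_contra! hno
  obtain ⟨ha, hb, -⟩ := h.1
  -- Without a neighbour in the component of `a`, the vertex `s` can be dropped from the separator.
  have hsep : G.IsSeparatorOf a b (S \ {s}) := by
    refine ⟨fun h' => ha h'.1, fun h' => hb h'.1, fun heq => ?_⟩
    have hr := ConnectedComponent.exact heq
    have hbA : b ∈ G.componentAvoiding S a := by
      refine mem_of_reachable_induce (fun u v hu hv huv => ?_) hr (mem_componentAvoiding_self ha)
      by_cases hvS : v ∈ S
      · obtain rfl : v = s := by
          by_contra hne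
          exact hv ⟨hvS, hne⟩
        exact (hno u hu huv.symm).elim
      · exact mem_componentAvoiding_of_adj hu hvS huv
    exact h.1.notMem_component hbA (mem_componentAvoiding_self hb)
  exact (h.2 hsep Set.sdiff_subset hs).2 rfl

/-! ### Domination of a separator by two vertices -/

/-- Two vertices of an independent triple cannot have common neighbours in both `A` and `B`,
as `C₄` is forbidden, whereas a neighbour of one vertex of the triple is adjacent to a second one,
as `P₂ + 2P₁` is forbidden. These two conditions are incompatible. -/
theorem IsFamilyFree.not_independent_triple (hG : G.IsFamilyFree familyP2Plus2P1C4)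
    {A B : Set V} (hAB : ∀ x ∈ A, ∀ y ∈ B, ¬ G.Adj x y ∧ x ≠ y) {s t r : V}
    (hsA : ∃ x ∈ A, G.Adj s x) (hsB : ∃ y ∈ B, G.Adj s y)
    (htA : ∃ x ∈ A, G.Adj t x) (htB : ∃ y ∈ B, G.Adj t y)
    (hrA : ∃ x ∈ A, G.Adj r x) (hrB : ∃ y ∈ B, G.Adj r y)
    (hst : ¬ G.Adj s t) (hsr : ¬ G.Adj s r) (htr : ¬ G.Adj t r)
    (hst' : s ≠ t) (hsr' : s ≠ r) (htr' : t ≠ r) : False := by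
  let Common (C : Set V) (p q : V) : Prop := ∃ x ∈ C, G.Adj p x ∧ G.Adj q x
  have shared : ∀ (C : Set V) (p q w : V), (∃ x ∈ C, G.Adj p x) → ¬ G.Adj p q → ¬ G.Adj p w →
      ¬ G.Adj q w → q ≠ w → Common C p q ∨ Common C p w := by
    rintro C p q w ⟨x, hxC, hx⟩ hpq hpw hqw hne
    by_contra! hno
    exact hG.not_p2Plus2P1 hx hpq hpw (fun h => hno.1 ⟨x, hxC, hx, h.symm⟩)
      (fun h => hno.2 ⟨x, hxC, hx, h.symm⟩) hqw hne
  have excl : ∀ p q : V, ¬ G.Adj p q → p ≠ q → Common A p q → ¬ Common B p q := by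
    rintro p q hpq hne ⟨x, hx, hpx, hqx⟩ ⟨y, hy, hpy, hqy⟩
    exact hG.not_c4 hpx hqx.symm hqy hpy.symm hpq (hAB x hx y hy).1 hne (hAB x hx y hy).2
  have hcomm : ∀ C p q, Common C p q → Common C q p := fun C p q ⟨x, hx, h⟩ => ⟨x, hx, h.symm⟩
  have hts : ¬ G.Adj t s := fun h => hst h.symm
  have hrs : ¬ G.Adj r s := fun h => hsr h.symm
  have hrt : ¬ G.Adj r t := fun h => htr h.symm
  have hs₁ := shared A s t r hsA hst hsr htr htr'
  have hs₂ := shared B s t r hsB hst hsr htr htr'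
  have ht₁ := (shared A t s r htA hts htr hsr hsr').imp_left (hcomm A t s)
  have ht₂ := (shared B t s r htB hts htr hsr hsr').imp_left (hcomm B t s)
  have hr₁ := (shared A r s t hrA hrs hrt hst hst').imp (hcomm A r s) (hcomm A r t)
  have hr₂ := (shared B r s t hrB hrs hrt hst hst').imp (hcomm B r s) (hcomm B r t)
  -- Each of `A` and `B` provides common neighbours for two of the three pairs, so one pair has
  -- common neighbours in both.
  have est := excl s t hst hst'
  have esr := excl s r hsr hsr'
  have etr := excl t r htr htr'
  clear_value Common
  clear shared excl hcomm
  grind only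

/-- Let `s ∈ S` have inclusion-minimal neighbourhood in `B`, and let `d ∈ B` be a neighbour of `s`.
The vertices of `S` not adjacent to `d` are not adjacent to `s`, so they form a clique, and a
neighbour `d'` of one that has minimal neighbourhood in `B` is adjacent to all of them. -/
theorem IsFamilyFree.exists_dominating_pair [Finite V] (hG : G.IsFamilyFree familyP2Plus2P1C4)
    {A B S : Set V} (hAB : ∀ x ∈ A, ∀ y ∈ B, ¬ G.Adj x y ∧ x ≠ y) (hSB : Disjoint S B)
    (hSA : ∀ s ∈ S, ∃ x ∈ A, G.Adj s x) (hSB' : ∀ s ∈ S, ∃ y ∈ B, G.Adj s y)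
    (hB : G.IsClique B) (hne : B.Nonempty) :
    ∃ d ∈ B, ∃ d' ∈ B, ∀ s ∈ S, G.Adj s d ∨ G.Adj s d' := by
  let N : V → Set V := fun s => {y | y ∈ B ∧ G.Adj s y}
  have nested : ∀ s ∈ S, ∀ t ∈ S, G.Adj s t → ¬ N s ⊆ N t → N t ⊆ N s := by
    intro s hs t ht hst hns y hy
    obtain ⟨x, hx, hxt⟩ := Set.not_subset.mp hns
    by_contra hys
    have hsy : ¬ G.Adj s y := fun h => hys ⟨hy.1, h⟩
    have htx : ¬ G.Adj t x := fun h => hxt ⟨hx.1, h⟩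
    have hxy : x ≠ y := fun h => hsy (h ▸ hx.2)
    exact hG.not_c4 hx.2 (hB hx.1 hy.1 hxy) hy.2.symm hst.symm hsy (fun h => htx h.symm)
      (fun h => hSB.notMem_of_mem_left hs (h ▸ hy.1))
      (fun h => hSB.notMem_of_mem_left ht (h ▸ hx.1))
  -- A neighbour in `B` of a vertex with minimal neighbourhood dominates the adjacent vertices.
  have dominated : ∀ T ⊆ S, ∀ s, MinimalFor (· ∈ T) N s → ∀ d ∈ N s, ∀ t ∈ T,
      G.Adj s t → G.Adj t d := by
    intro T hT s hs d hd t ht hst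
    by_cases h : N s ⊆ N t
    · exact (h hd).2
    · exact (hs.2 ht (nested s (hT hs.1) t (hT ht) hst h) hd).2
  obtain ⟨b, hb⟩ := hne
  rcases S.eq_empty_or_nonempty with rfl | hS
  · exact ⟨b, hb, b, hb, by simp⟩
  obtain ⟨s, hs⟩ := (Set.toFinite S).exists_minimalFor N S hS
  obtain ⟨d, hdB, hsd⟩ := hSB' s hs.1
  let T : Set V := {t | t ∈ S ∧ ¬ G.Adj t d}
  have hTs : ∀ t ∈ T, ¬ G.Adj s t ∧ s ≠ t := fun t ht =>
    ⟨fun h => ht.2 (dominated S subset_rfl s hs d ⟨hdB, hsd⟩ t ht.1 h), fun h => ht.2 (h ▸ hsd)⟩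
  rcases T.eq_empty_or_nonempty with hT | hT
  · refine ⟨d, hdB, d, hdB, fun t ht => Or.inl ?_⟩
    by_contra h
    exact hT.subset (show t ∈ T from ⟨ht, h⟩)
  obtain ⟨t, ht⟩ := (Set.toFinite T).exists_minimalFor N T hT
  obtain ⟨d', hdB', htd⟩ := hSB' t ht.1.1
  refine ⟨d, hdB, d', hdB', fun r hr => ?_⟩
  by_contra! hno
  have hrT : r ∈ T := ⟨hr, hno.1⟩
  have htr : ¬ G.Adj t r := fun h =>
    hno.2 (dominated T (fun _ h => h.1) t ht d' ⟨hdB', htd⟩ r hrT h)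
  exact hG.not_independent_triple hAB (hSA s hs.1) (hSB' s hs.1) (hSA t ht.1.1) (hSB' t ht.1.1)
    (hSA r hr) (hSB' r hr) (hTs t ht.1).1 (hTs r hrT).1 htr (hTs t ht.1).2 (hTs r hrT).2
    (fun h => hno.2 (h ▸ htd))

/-! ### Counting minimal separators -/

/-- The boundary of `A`: the vertices outside `A` that have a neighbour in `A`. -/
def vertexBoundary (G : SimpleGraph V) (A : Set V) : Set V :=
  {v | v ∉ A ∧ ∃ x ∈ A, G.Adj v x}

/-- The boundary of the set of vertices outside the closed neighbourhoods of `p.1` and `p.2`. -/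
def farBoundary (G : SimpleGraph V) (p : V × V) : Set V :=
  G.vertexBoundary {v | v ≠ p.1 ∧ v ≠ p.2 ∧ ¬ G.Adj v p.1 ∧ ¬ G.Adj v p.2}

theorem IsMinimalSeparatorOf.eq_vertexBoundary {a b : V} {S : Set V}
    (h : G.IsMinimalSeparatorOf a b S) : S = G.vertexBoundary (G.componentAvoiding S a) := by
  ext v
  refine ⟨fun hv => ⟨fun h' => notMem_of_mem_componentAvoiding h' hv, h.exists_adj_component hv⟩,
    ?_⟩
  rintro ⟨hv, x, hx, hvx⟩
  by_contra hvS
  exact hv (mem_componentAvoiding_of_adj hx hvS hvx.symm)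

theorem IsMinimalSeparatorOf.eq_neighborSet {a b : V} {S : Set V}
    (h : G.IsMinimalSeparatorOf a b S)
    (hA : ∀ u ∈ G.componentAvoiding S a, ∀ v ∈ G.componentAvoiding S a, ¬ G.Adj u v) :
    S = G.neighborSet a := by
  have haS : a ∉ S := h.1.1
  have hsub := componentAvoiding_subset_of_edgeless hA
  have ha := mem_componentAvoiding_self (G := G) haS
  ext v
  constructor
  · intro hv
    obtain ⟨x, hx, hvx⟩ := h.exists_adj_component hv
    obtain rfl : x = a := hsub hx
    exact hvx.symm
  · intro hv
    by_contra hvS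
    exact hA a ha v (mem_componentAvoiding_of_adj ha hvS hv) hv

theorem IsMinimalSeparatorOf.not_adj_components {a b : V} {S : Set V}
    (h : G.IsMinimalSeparatorOf a b S) :
    ∀ x ∈ G.componentAvoiding S a, ∀ y ∈ G.componentAvoiding S b, ¬ G.Adj x y ∧ x ≠ y := by
  refine fun x hx y hy => ⟨fun hxy => ?_, ?_⟩
  · exact h.1.notMem_component
      (mem_componentAvoiding_of_adj hx (notMem_of_mem_componentAvoiding hy) hxy) hy
  · rintro rfl
    exact h.1.notMem_component hx hy

theorem IsMinimalSeparatorOf.exists_eq_farBoundary [Finite V]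
    (hG : G.IsFamilyFree familyP2Plus2P1C4) {a b : V} {S : Set V}
    (h : G.IsMinimalSeparatorOf a b S)
    (hcover : ∀ v, v ∉ S → v ∈ G.componentAvoiding S a ∨ v ∈ G.componentAvoiding S b)
    (hB : G.IsClique (G.componentAvoiding S b)) : ∃ p, G.farBoundary p = S := by
  have hAB := h.not_adj_components
  have hSB : Disjoint S (G.componentAvoiding S b) :=
    Set.disjoint_left.mpr fun v hv hv' => notMem_of_mem_componentAvoiding hv' hv
  obtain ⟨d, hd, d', hd', hdom⟩ := hG.exists_dominating_pair hAB hSB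
    (fun s hs => h.exists_adj_component hs) (fun s hs => h.symm.exists_adj_component hs) hB
    ⟨b, mem_componentAvoiding_self h.1.2.1⟩
  refine ⟨(d, d'), ?_⟩
  conv_rhs => rw [h.eq_vertexBoundary]
  refine congrArg G.vertexBoundary (Set.ext fun v => ⟨?_, fun hv => ?_⟩)
  · rintro ⟨h1, h2, h3, h4⟩
    by_contra hv
    have hvS : v ∉ S := fun hvS => (hdom v hvS).elim h3 h4
    exact h3 (hB ((hcover v hvS).resolve_left hv) hd h1)
  · exact ⟨(hAB v hv d hd).2, (hAB v hv d' hd').2, (hAB v hv d hd).1, (hAB v hv d' hd').1⟩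

theorem IsFamilyFree.minimalSeparators_subset [Finite V]
    (hG : G.IsFamilyFree familyP2Plus2P1C4) :
    G.minimalSeparators ⊆ Set.range G.farBoundary ∪ Set.range G.neighborSet := by
  rintro S ⟨a, b, -, -, h⟩
  have hAB := h.not_adj_components
  by_cases hA : ∀ u ∈ G.componentAvoiding S a, ∀ v ∈ G.componentAvoiding S a, ¬ G.Adj u v
  · exact Or.inr ⟨a, (h.eq_neighborSet hA).symm⟩
  push Not at hA
  obtain ⟨u, hu, v, hv, huv⟩ := hA
  have hbB := mem_componentAvoiding_self (G := G) h.1.2.1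
  refine Or.inl (h.exists_eq_farBoundary hG (fun w hw => ?_) fun x hx y hy hne => ?_)
  · -- A vertex of a third component would form `P₂ + 2P₁` with `b` and the edge `uv`.
    by_contra! hno
    exact hG.not_p2Plus2P1 huv
      (fun e => hno.1 (mem_componentAvoiding_of_adj hu hw e)) (hAB u hu b hbB).1
      (fun e => hno.1 (mem_componentAvoiding_of_adj hv hw e)) (hAB v hv b hbB).1
      (fun e => hno.2 (mem_componentAvoiding_of_adj hbB hw e.symm)) (fun e => hno.2 (e ▸ hbB))
  · by_contra hxy
    exact hG.not_p2Plus2P1 huv (hAB u hu x hx).1 (hAB u hu y hy).1 (hAB v hv x hx).1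
      (hAB v hv y hy).1 hxy hne

theorem IsFamilyFree.numMinimalSeparators_le [Finite V]
    (hG : G.IsFamilyFree familyP2Plus2P1C4) :
    G.numMinimalSeparators ≤ Nat.card V ^ 2 + Nat.card V := by
  have hrange : ∀ {ι : Type u} [Finite ι] (f : ι → Set V), (Set.range f).ncard ≤ Nat.card ι := by
    intro ι _ f
    rw [← Set.image_univ, ← Set.ncard_univ]
    exact Set.ncard_image_le Set.finite_univ
  calc G.minimalSeparators.ncard
      ≤ (Set.range G.farBoundary ∪ Set.range G.neighborSet).ncard :=
        Set.ncard_le_ncard hG.minimalSeparators_subset (Set.toFinite _)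
    _ ≤ (Set.range G.farBoundary).ncard + (Set.range G.neighborSet).ncard :=
        Set.ncard_union_le _ _
    _ ≤ Nat.card (V × V) + Nat.card V := add_le_add (hrange _) (hrange _)
    _ = Nat.card V ^ 2 + Nat.card V := by rw [Nat.card_prod, sq]

end SimpleGraph

theorem isBoundedBy_familyP2Plus2P1C4 :
    (familyFreeClass.{u} familyP2Plus2P1C4).IsBoundedBy (Polynomial.X ^ 2 + Polynomial.X) := by
  intro V _ _ G hG
  simpa using (Nat.cast_le (α := ℝ)).mpr (SimpleGraph.IsFamilyFree.numMinimalSeparators_le hG)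

theorem mainTheorem7 :
    (familyFreeClass.{u} familyP2Plus2P1C4).IsTame ∧
      ∃ p : Polynomial ℝ, p.natDegree ≤ 3 ∧
        (familyFreeClass.{u} familyP2Plus2P1C4).IsBoundedBy p := by
  refine ⟨⟨_, isBoundedBy_familyP2Plus2P1C4⟩, _, ?_, isBoundedBy_familyP2Plus2P1C4⟩
  compute_degree!
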